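/- Let $d_s,d_a\in\mathbb N$, and let $c:\mathbb R^{d_s+d_a}\times\mathbb R^{d_s+d_a}\to\mathbb R$ be a kernel for which there are constants $C>0$, $L>0$ and $\alpha\in(0,1]$ such that $0<c(x,x)\le C$ for all $x$ and $|c(x,y)-c(x,z)|\le L\|y-z\|_2^{\alpha}$ for all $x,y,z\in\mathbb R^{d_s+d_a}$. Let $f_1,\dots,f_{d_s}$ be independent zero-mean Gaussian processes on $\mathbb R^{d_s+d_a}$ with covariance function $c$, and let $f=(f_1,\dots,f_{d_s})$. Let $R>0$, let $\mathbb B(R)=\{x\in\mathbb R^{d_s+d_a}:\|x\|_2\le R\}$, and suppose that the process $(f(x))_{x\in\mathbb B(R)}$ is separable, i.e. there is a countable set $Z_0\subseteq\mathbb B(R)$ such that, almost surely, for every $x\in\mathbb B(R)$ there is a sequence $(z_n)$ in $Z_0$ with $z_n\to x$ and $f(z_n)\to f(x)$. Then for every $$u\ \ge\ 84\,\alpha^{-1/2}\sqrt{C(d_s+d_a)\log\!\big(5+5R^{\alpha}L/C\big)}$$ we have $$\mathbb P\Big(\sup_{x\in\mathbb B(R)}\|f(x)\|_2\ge u\Big)\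 \le\ \exp\!\Big(-\frac{u^2}{8C}\Big).$$ -/

import Mathlib

open MeasureTheory ProbabilityTheory Filter Topology

namespace GPTail

/-- `f ∼ GP(0, c)` under `μ`: all finite-dimensional marginals of `f` are Gaussian, with mean zero
and covariance function `c`. -/
structure IsCenteredGP {T Ω : Type*} [MeasurableSpace Ω] (μ : Measure Ω) (f : T → Ω → ℝ)
    (c : T → T → ℝ) : Prop where
  isGaussianProcess : IsGaussianProcess f μ
  mean_eq_zero : ∀ x, ∫ ω, f x ω ∂μ = 0
  covariance_eq : ∀ x y, covariance (f x) (f y) μ = c x y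

/-- The kernel `c` is positive on the diagonal and bounded there by the positive constant `C`. -/
structure IsBoundedKernel {T : Type*} (c : T → T → ℝ) (C : ℝ) : Prop where
  const_pos : 0 < C
  diag_pos : ∀ x, 0 < c x x
  diag_le : ∀ x, c x x ≤ C

/-- The kernel `c` is Hölder continuous with constant `L > 0` and exponent `α ∈ (0, 1]`. -/
structure IsHolderKernel {T : Type*} [NormedAddCommGroup T] (c : T → T → ℝ) (L α : ℝ) : Prop where
  const_pos : 0 < L
  exponent_pos : 0 < α
  exponent_le_one : α ≤ 1
  abs_sub_le : ∀ x y z, |c x y - c x z| ≤ L * ‖y - z‖ ^ α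

/-- The process `(X x)` with `x ∈ Z` is separable: there is a countable `Z₀ ⊆ Z` such that, almost
surely, for all `x ∈ Z`, the value `X x` is the limit of `X` along some sequence in `Z₀` that
converges to `x`. -/
def IsSeparableOn {T E Ω : Type*} [TopologicalSpace T] [TopologicalSpace E] [MeasurableSpace Ω]
    (μ : Measure Ω) (X : T → Ω → E) (Z : Set T) : Prop :=
  ∃ Z₀ : Set T, Z₀ ⊆ Z ∧ Z₀.Countable ∧ ∀ᵐ ω ∂μ, ∀ x ∈ Z, ∃ z : ℕ → T, (∀ n, z n ∈ Z₀) ∧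
    Tendsto z atTop (𝓝 x) ∧ Tendsto (fun n => X (z n) ω) atTop (𝓝 (X x ω))

/-- The vector-valued process `f = (f₁, …, f_d)` with values in Euclidean space. -/
def vecField {T Ω : Type*} {d : ℕ} (f : Fin d → T → Ω → ℝ) (x : T) (ω : Ω) :
    EuclideanSpace ℝ (Fin d) :=
  WithLp.toLp 2 fun i => f i x ω

end GPTail

/-! ### Gaussian vector tails -/

open scoped NNReal ENNReal

/-! The proof is chaining with explicit constants. Independence and Markov's inequality for `exp (x
^ 2 / (4 * s))` give a vector tail `2 ^ d * exp (-t ^ 2 / (4 * s))`; Hölder continuity of `c` makes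
the increment variance at distance `r` at most `2 * L * r ^ α`.

Nets of the ball are taken at radii with `L * r k ^ α = C * 4 ^ (-(6 + k))`. Their log-cardinality
grows linearly in `k` (volume comparison), while the exponent of a link of size `(3 / 4) ^ (k + 1) /
20 * u` grows like `(9 / 4) ^ k`. The hypothesis on `u` lets the exponents absorb the entropy, so
the level-`k` failure probability is at most `2 ^ (-(k + 1)) * exp (-u ^ 2 / (8 * C))`, which sums
to the claim.

Off these events all nets are bounded by `19 / 20 * u`. Increments vanish in probability, which
carries the bound to the countable set `Z₀`, and separability carries it to the ball; continuous
paths are not needed. -/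

/-- Exponential square moment of a centered real Gaussian with variance at most `s`. -/
theorem lintegral_exp_sq_gaussianReal_le {v : ℝ≥0} {s : ℝ} (hv : (v : ℝ) ≤ s) :
    ∫⁻ x, ENNReal.ofReal (Real.exp (x ^ 2 / (4 * s))) ∂(gaussianReal 0 v) ≤ 2 := by
  rcases eq_or_ne v 0 with rfl | hv0
  · rw [gaussianReal_zero_var, lintegral_dirac' _ (by fun_prop)]
    simp
  have hvpos : (0 : ℝ) < v := by positivity
  rw [gaussianReal_of_var_ne_zero _ hv0,
    lintegral_withDensity_eq_lintegral_mul _ (measurable_gaussianPDF 0 v) (by fun_prop)]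
  have hsqrt : √(2 * Real.pi * (2 * v : ℝ)) ≤ 2 * √(2 * Real.pi * v) := by
    rw [Real.sqrt_le_left (by positivity), mul_pow, Real.sq_sqrt (by positivity)]
    nlinarith [mul_pos Real.pi_pos hvpos]
  calc
    -- The weight halves the Gaussian exponent at worst, leaving `√2` times the density of variance
    -- `2 * v`.
    _ ≤ ∫⁻ x, 2 * gaussianPDF 0 (2 * v) x := by
      refine lintegral_mono fun x => ?_
      simp only [Pi.mul_apply, gaussianPDF, gaussianPDFReal]
      rw [← ENNReal.ofReal_mul (by positivity),
        show (2 : ℝ≥0∞) = ENNReal.ofReal 2 by simp, ← ENNReal.ofReal_mul (by norm_num)]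
      refine ENNReal.ofReal_le_ofReal ?_
      push_cast
      rw [mul_assoc, ← Real.exp_add, ← mul_assoc]
      refine mul_le_mul ?_ (Real.exp_le_exp.2 ?_) (Real.exp_pos _).le (by positivity)
      · rw [← div_eq_mul_inv, inv_eq_one_div, div_le_div_iff₀ (by positivity) (by positivity)]
        linarith
      · have h1 : x ^ 2 / (4 * s) ≤ x ^ 2 / (4 * v) := by gcongr
        have h2 : -(x - 0) ^ 2 / (2 * (v : ℝ)) + x ^ 2 / (4 * v)
            = -(x - 0) ^ 2 / (2 * (2 * v)) := by
          field_simp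
          ring
        linarith
    _ = 2 := by
      rw [lintegral_const_mul _ (measurable_gaussianPDF 0 (2 * v)),
        lintegral_gaussianPDF_eq_one 0 (mul_ne_zero two_ne_zero hv0), mul_one]

/-- Tail bound for the Euclidean norm of a vector of independent centered Gaussians. -/
theorem measure_le_norm_toLp_le {Ω ι : Type*} [MeasurableSpace Ω] [Fintype ι] {μ : Measure Ω}
    {X : ι → Ω → ℝ} (hX : ∀ i, HasGaussianLaw (X i) μ) (hmean : ∀ i, ∫ ω, X i ω ∂μ = 0)
    (hind : iIndepFun X μ) {s : ℝ} (hs : 0 < s) (hvar : ∀ i, Var[X i; μ] ≤ s) {t : ℝ}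
    (ht : 0 ≤ t) :
    μ {ω | t ≤ ‖(WithLp.toLp 2 fun i => X i ω : EuclideanSpace ℝ ι)‖}
      ≤ ENNReal.ofReal (2 ^ Fintype.card ι * Real.exp (-(t ^ 2 / (4 * s)))) := by
  have hae : ∀ i, AEMeasurable (X i) μ := fun i => (hX i).aemeasurable
  let g : ℝ → ℝ≥0∞ := fun x => ENNReal.ofReal (Real.exp (x ^ 2 / (4 * s)))
  have hg : Measurable g := by fun_prop
  -- The product formula for integrals needs measurable factors; the `X i` are only a.e. measurable.
  let Y : ι → Ω → ℝ := fun i => (hae i).mk (X i)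
  have hXY : ∀ i, X i =ᵐ[μ] Y i := fun i => (hae i).ae_eq_mk
  have hY : ∀ i, Measurable (Y i) := fun i => (hae i).measurable_mk
  have hone : ∀ i, ∫⁻ ω, g (Y i ω) ∂μ ≤ 2 := fun i => by
    have h := lintegral_congr_ae ((hXY i).fun_comp g)
    simp only [Function.comp_apply] at h
    rw [← h, ← lintegral_map' hg.aemeasurable (hae i),
      (hX i).map_eq_gaussianReal, hmean i]
    exact lintegral_exp_sq_gaussianReal_le
      (by rw [Real.coe_toNNReal _ (variance_nonneg _ _)]; exact hvar i)
  have hprod : ∫⁻ ω, ∏ i, g (Y i ω) ∂μ ≤ 2 ^ Fintype.card ι := by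
    rw [lintegral_prod_eq_prod_lintegral_of_indepFun Finset.univ (fun i ω => g (Y i ω))
      ((hind.congr hXY).comp (fun _ => g) fun _ => hg) fun i => hg.comp (hY i)]
    exact (Finset.prod_le_prod' fun i _ => hone i).trans_eq (by simp)
  have hsub : μ {ω | t ≤ ‖(WithLp.toLp 2 fun i => X i ω : EuclideanSpace ℝ ι)‖}
      ≤ μ {ω | g t ≤ ∏ i, g (Y i ω)} := by
    refine measure_mono_ae ?_
    filter_upwards [ae_all_iff.2 hXY] with ω hω h
    change g t ≤ ∏ i, g (Y i ω)
    replace h : t ≤ ‖(WithLp.toLp 2 fun i => X i ω : EuclideanSpace ℝ ι)‖ := h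
    simp only [g]
    rw [← ENNReal.ofReal_prod_of_nonneg fun _ _ => (Real.exp_pos _).le, ← Real.exp_sum,
      ← Finset.sum_div]
    have h2 : t ^ 2 ≤ ∑ i, Y i ω ^ 2 := by
      have := pow_le_pow_left₀ ht h 2
      rw [EuclideanSpace.real_norm_sq_eq] at this
      simpa [hω] using this
    gcongr
  refine hsub.trans ((meas_ge_le_lintegral_div (by fun_prop) (by simp [g, Real.exp_pos])
    (by simp [g])).trans ?_)
  refine (ENNReal.div_le_div_right hprod _).trans_eq ?_
  simp only [g]
  rw [Real.exp_neg, ← div_eq_mul_inv, ENNReal.ofReal_div_of_pos (Real.exp_pos _),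
    ENNReal.ofReal_pow (by norm_num)]
  simp

/-! ### Nets of a ball -/

/-- Volumetric bound on the cardinality of an `r`-separated subset of a ball. -/
theorem Metric.card_le_of_isSeparated_closedBall {E : Type*} [NormedAddCommGroup E]
    [NormedSpace ℝ E] [FiniteDimensional ℝ E] {R r : ℝ} (hR : 0 ≤ R) (hr : 0 < r) (S : Finset E)
    (hS : (S : Set E) ⊆ closedBall 0 R) (hsep : ∀ c ∈ S, ∀ d ∈ S, c ≠ d → r ≤ dist c d) :
    (S.card : ℝ) ≤ (1 + 2 * R / r) ^ Module.finrank ℝ E := by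
  borelize E
  let μ : Measure E := Measure.addHaar
  have hδ : 0 < r / 2 := by positivity
  have hρ : 0 < R + r / 2 := by positivity
  have D : (S : Set E).Pairwise (Function.onFun Disjoint fun c => ball c (r / 2)) := by
    intro c hc d hd hcd
    exact ball_disjoint_ball (by linarith [hsep c hc d hd hcd])
  have A_subset : ⋃ c ∈ S, ball c (r / 2) ⊆ ball (0 : E) (R + r / 2) := by
    refine Set.iUnion₂_subset fun x hx => ball_subset_ball' ?_
    have := mem_closedBall.1 (hS hx)
    linarith
  have I : (S.card : ℝ≥0∞) * ENNReal.ofReal ((r / 2) ^ Module.finrank ℝ E) * μ (ball 0 1) ≤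
      ENNReal.ofReal ((R + r / 2) ^ Module.finrank ℝ E) * μ (ball 0 1) := by
    have := measure_mono (μ := μ) A_subset
    rw [measure_biUnion_finset D fun c _ => measurableSet_ball] at this
    simpa only [μ.addHaar_ball_of_pos _ hδ, μ.addHaar_ball_of_pos _ hρ, Finset.sum_const,
      nsmul_eq_mul, mul_assoc] using this
  have J := (ENNReal.mul_le_mul_iff_left (measure_ball_pos _ _ zero_lt_one).ne'
    measure_ball_lt_top.ne).1 I
  have K := ENNReal.toReal_le_of_le_ofReal (pow_nonneg hρ.le _) J
  rw [ENNReal.toReal_mul, ENNReal.toReal_natCast, ENNReal.toReal_ofReal (by positivity),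
    ← le_div_iff₀ (by positivity), ← div_pow] at K
  rwa [show (R + r / 2) / (r / 2) = 1 + 2 * R / r by field_simp; ring] at K

/-- A ball has an `r`-net inside it whose cardinality obeys the volumetric bound. -/
theorem Metric.exists_finset_net_closedBall {E : Type*} [NormedAddCommGroup E]
    [NormedSpace ℝ E] [FiniteDimensional ℝ E] {R r : ℝ} (hR : 0 ≤ R) (hr : 0 < r) :
    ∃ S : Finset E, (S : Set E) ⊆ closedBall 0 R ∧
      (∀ x ∈ closedBall (0 : E) R, ∃ y ∈ S, dist x y ≤ r) ∧
      (S.card : ℝ) ≤ (1 + 2 * R / r) ^ Module.finrank ℝ E := by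
  have := FiniteDimensional.proper ℝ E
  lift r to ℝ≥0 using hr.le
  have hr' : r ≠ 0 := by rintro rfl; simp at hr
  have hfin : packingNumber r (closedBall (0 : E) R) ≠ ⊤ := by
    obtain ⟨N, -, hNf, hN⟩ := exists_finite_isCover_of_isCompact
      (ε := r / 2) (by positivity) (isCompact_closedBall (0 : E) R)
    have h := packingNumber_two_mul_le_externalCoveringNumber (r / 2) (closedBall (0 : E) R)
    rw [mul_div_cancel₀ _ two_ne_zero] at h
    exact ((h.trans (iInf₂_le N hN)).trans_lt hNf.encard_lt_top).ne
  obtain ⟨hcov, hsep⟩ := And.intro (isCover_maximalSeparatedSet hfin)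
    (isSeparated_maximalSeparatedSet (ε := r) (A := closedBall (0 : E) R))
  have hSf : (maximalSeparatedSet r (closedBall (0 : E) R)).Finite :=
    Set.encard_ne_top_iff.1 (by rwa [encard_maximalSeparatedSet hfin])
  refine ⟨hSf.toFinset, by simpa using maximalSeparatedSet_subset, fun x hx => ?_,
    card_le_of_isSeparated_closedBall hR hr _ (by simpa using maximalSeparatedSet_subset) ?_⟩
  · obtain ⟨y, hy, hxy⟩ := hcov hx
    refine ⟨y, by simpa using hy, ?_⟩
    have : edist x y ≤ r := hxy
    rwa [edist_nndist, ENNReal.coe_le_coe, ← NNReal.coe_le_coe, coe_nndist] at this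
  · intro c hc d hd hcd
    have : (r : ℝ≥0∞) < edist c d := hsep (by simpa using hc) (by simpa using hd) hcd
    rw [edist_nndist, ENNReal.coe_lt_coe, ← NNReal.coe_lt_coe, coe_nndist] at this
    exact this.le

namespace GPTail

/-! ### Tails of the field and its increments -/

section Increments

variable {T Ω : Type*} [MeasurableSpace Ω] {μ : Measure Ω}

theorem IsCenteredGP.hasGaussianLaw_eval {f : T → Ω → ℝ} {c : T → T → ℝ}
    (hf : IsCenteredGP μ f c) (x : T) : HasGaussianLaw (f x) μ :=
  hf.isGaussianProcess.hasGaussianLaw_eval x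

theorem IsCenteredGP.hasGaussianLaw_sub {f : T → Ω → ℝ} {c : T → T → ℝ}
    (hf : IsCenteredGP μ f c) (x y : T) : HasGaussianLaw (f x - f y) μ :=
  hf.isGaussianProcess.hasGaussianLaw_sub

theorem IsCenteredGP.variance_eq {f : T → Ω → ℝ} {c : T → T → ℝ} (hf : IsCenteredGP μ f c)
    (x : T) : Var[f x; μ] = c x x := by
  rw [← covariance_self (hf.isGaussianProcess.aemeasurable x), hf.covariance_eq]

theorem IsCenteredGP.variance_sub_le [IsProbabilityMeasure μ] [NormedAddCommGroup T] {f : T → Ω → ℝ} {c : T → T → ℝ}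
    (hf : IsCenteredGP μ f c) {L α : ℝ} (hL : IsHolderKernel c L α) (x y : T) :
    Var[f x - f y; μ] ≤ 2 * (L * ‖x - y‖ ^ α) := by
  rw [variance_sub (hf.hasGaussianLaw_eval x).memLp_two
    (hf.hasGaussianLaw_eval y).memLp_two, hf.variance_eq, hf.variance_eq,
    hf.covariance_eq]
  have hsymm : c x y = c y x := by rw [← hf.covariance_eq, covariance_comm, hf.covariance_eq]
  have h1 := (le_abs_self _).trans (hL.abs_sub_le x x y)
  have h2 := (le_abs_self _).trans (hL.abs_sub_le y y x)
  rw [norm_sub_rev] at h2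
  linarith

variable {d : ℕ} {f : Fin d → T → Ω → ℝ} {c : T → T → ℝ}

theorem measure_le_norm_vecField_le (hf : ∀ i, IsCenteredGP μ (f i) c)
    (hind : iIndepFun (fun i ω x => f i x ω) μ) {C : ℝ} (hC : IsBoundedKernel c C) (x : T) {t : ℝ}
    (ht : 0 ≤ t) :
    μ {ω | t ≤ ‖vecField f x ω‖} ≤ ENNReal.ofReal (2 ^ d * Real.exp (-(t ^ 2 / (4 * C)))) := by
  have h := measure_le_norm_toLp_le (X := fun i => f i x)
    (fun i => (hf i).hasGaussianLaw_eval x) (fun i => (hf i).mean_eq_zero x)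
    (hind.comp (fun _ g => g x) fun _ => measurable_pi_apply x) hC.const_pos
    (fun i => ((hf i).variance_eq x).trans_le (hC.diag_le x)) ht
  rw [Fintype.card_fin] at h
  exact h

theorem measure_le_norm_vecField_sub_le [IsProbabilityMeasure μ] [NormedAddCommGroup T]
    (hf : ∀ i, IsCenteredGP μ (f i) c) (hind : iIndepFun (fun i ω x => f i x ω) μ) {L α : ℝ}
    (hL : IsHolderKernel c L α) {x y : T} {r : ℝ} (hr : 0 < r) (hxy : dist x y ≤ r) {t : ℝ}
    (ht : 0 ≤ t) :
    μ {ω | t ≤ ‖vecField f x ω - vecField f y ω‖}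
      ≤ ENNReal.ofReal (2 ^ d * Real.exp (-(t ^ 2 / (8 * (L * r ^ α))))) := by
  have hs : 0 < 2 * (L * r ^ α) := by
    have := hL.const_pos
    positivity
  have h := measure_le_norm_toLp_le (X := fun i => f i x - f i y)
    (fun i => (hf i).hasGaussianLaw_sub x y)
    (fun i => by
      simp only [Pi.sub_apply]
      rw [integral_sub ((hf i).hasGaussianLaw_eval x).integrable
        ((hf i).hasGaussianLaw_eval y).integrable, (hf i).mean_eq_zero,
        (hf i).mean_eq_zero, sub_zero])
    (hind.comp (fun _ g => g x - g y) fun _ =>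
      (measurable_pi_apply x).sub (measurable_pi_apply y)) hs
    (fun i => ((hf i).variance_sub_le hL x y).trans <| by
      have := hL.const_pos
      have := hL.exponent_pos
      rw [dist_eq_norm] at hxy
      gcongr) ht
  rw [show 4 * (2 * (L * r ^ α)) = 8 * (L * r ^ α) by ring, Fintype.card_fin] at h
  exact h

end Increments

/-! ### Chaining and calibration of constants -/

theorem measure_biUnion_finset_le_exp {T Ω : Type*} [MeasurableSpace Ω] {μ : Measure Ω}
    {S : Finset T} {B : T → Set Ω} {d : ℕ} {m e : ℝ} (hcard : (S.card : ℝ) ≤ Real.exp m)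
    (hB : ∀ t ∈ S, μ (B t) ≤ ENNReal.ofReal (2 ^ d * Real.exp (-e))) :
    μ (⋃ t ∈ S, B t) ≤ ENNReal.ofReal (Real.exp (m + d - e)) := by
  refine (measure_biUnion_finset_le S B).trans ((Finset.sum_le_card_nsmul _ _ _ hB).trans ?_)
  rw [nsmul_eq_mul, ← ENNReal.ofReal_natCast, ← ENNReal.ofReal_mul (Nat.cast_nonneg _)]
  refine ENNReal.ofReal_le_ofReal ?_
  have h2 : (2 : ℝ) ^ d ≤ Real.exp d := by
    rw [← mul_one (d : ℝ), Real.exp_nat_mul]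
    have := Real.add_one_le_exp (1 : ℝ)
    gcongr
    linarith
  rw [sub_eq_add_neg, Real.exp_add, Real.exp_add, mul_assoc]
  gcongr

/-- A bound on the links of a chain of nets gives a bound on each net. -/
theorem norm_le_of_chain {T F : Type*} [NormedAddCommGroup F] {X : T → F} {S : ℕ → Finset T}
    {near : ℕ → T → T} {u : ℝ} (h0 : ∀ t ∈ S 0, ‖X t‖ ≤ 4 / 5 * u)
    (hnear : ∀ k, ∀ t ∈ S (k + 1), near k t ∈ S k)
    (hstep : ∀ k, ∀ t ∈ S (k + 1), ‖X t - X (near k t)‖ ≤ (3 / 4) ^ (k + 1) / 20 * u) (k : ℕ) :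
    ∀ t ∈ S k, ‖X t‖ ≤ (19 / 20 - 3 / 20 * (3 / 4) ^ k) * u := by
  -- The coefficient is `4 / 5` plus the partial sum of the links, whose full series is `3 / 20`.
  induction k with
  | zero => exact fun t ht => (h0 t ht).trans_eq (by ring)
  | succ k ih =>
    intro t ht
    calc ‖X t‖ ≤ ‖X (near k t)‖ + ‖X t - X (near k t)‖ := norm_le_insert' _ _
      _ ≤ _ := add_le_add (ih _ (hnear k t ht)) (hstep k t ht)
      _ = _ := by ring

/-- `R / r` equals `(A * 4 ^ (6 + k)) ^ α⁻¹` with `A = R ^ α * L / C`. Since `α⁻¹ ≥ 1`, the factor 3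
fits into `5 ^ α⁻¹`, and each 4 is at most `5 * (1 + A)`. -/
theorem one_add_two_mul_div_le_exp {R C L α a r : ℝ} (hR : 0 < R) (hC : 0 < C) (hL : 0 < L)
    (hα : 0 < α) (hα1 : α ≤ 1) (hr : 0 < r) (k : ℕ) (ha : a = (1 / 4) ^ (6 + k))
    (hra : L * r ^ α = C * a) :
    1 + 2 * R / r ≤ Real.exp (Real.log (5 + 5 * R ^ α * L / C) * (7 + k) / α) := by
  have hA : 0 ≤ R ^ α * L / C := by positivity
  set A := R ^ α * L / C with hAdef
  have hapos : 0 < a := by rw [ha]; positivity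
  have hlog : 5 + 5 * R ^ α * L / C = 5 * (1 + A) := by rw [hAdef]; ring
  set y : ℝ := (1 + A) * 4 ^ (6 + k) with hy
  have hy1 : 1 ≤ y := one_le_mul_of_one_le_of_one_le (by linarith) (one_le_pow₀ (by norm_num))
  have hRr : R / r ≤ y ^ α⁻¹ := by
    rw [Real.le_rpow_inv_iff_of_pos (by positivity) (by linarith) hα,
      Real.div_rpow hR.le hr.le, div_le_iff₀ (by positivity)]
    have hra' : r ^ α = C * a / L := by field_simp; linarith
    have : R ^ α = A * 4 ^ (6 + k) * (C * a / L) := by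
      rw [hAdef, ha, one_div, inv_pow]
      field_simp
    rw [hra', this, hy]
    gcongr
    linarith
  have hp : 1 ≤ α⁻¹ := (one_le_inv₀ hα).2 hα1
  have h1 : 1 ≤ y ^ α⁻¹ := Real.one_le_rpow hy1 (by linarith)
  have h5 : (3 : ℝ) ≤ 5 ^ α⁻¹ := by
    have := Real.rpow_le_rpow_of_exponent_le (x := 5) (by norm_num) hp
    rw [Real.rpow_one] at this
    linarith
  have hexp : 5 * y ≤ Real.exp (Real.log (5 * (1 + A)) * (7 + k)) := by
    rw [show (7 + k : ℝ) = ((1 + (6 + k) : ℕ) : ℝ) by push_cast; ring, mul_comm (Real.log _),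
      Real.exp_nat_mul, Real.exp_log (by linarith), pow_add, pow_one, hy, ← mul_assoc]
    gcongr
    linarith
  calc 1 + 2 * R / r = 1 + 2 * (R / r) := by ring
    _ ≤ 3 * y ^ α⁻¹ := by linarith
    _ ≤ 5 ^ α⁻¹ * y ^ α⁻¹ := by gcongr
    _ = (5 * y) ^ α⁻¹ := (Real.mul_rpow (by norm_num) (by linarith)).symm
    _ ≤ _ := Real.rpow_le_rpow (by linarith) hexp (by linarith)
    _ = _ := by rw [← Real.exp_mul, hlog, div_eq_mul_inv]

theorem entropy_le_sq {n C α Λ u : ℝ} (hn : 0 ≤ n) (hC : 0 < C) (hα : 0 < α) (hΛ : 0 ≤ Λ)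
    (hu : 84 * α ^ (-(1 / 2) : ℝ) * √(C * n * Λ) ≤ u) :
    7056 * (n * Λ / α) ≤ u ^ 2 / C := by
  have h := pow_le_pow_left₀ (by positivity) hu 2
  rw [mul_pow, mul_pow, Real.sq_sqrt (by positivity), ← Real.rpow_natCast (α ^ _),
    ← Real.rpow_mul hα.le, show (-(1 / 2) : ℝ) * ((2 : ℕ) : ℝ) = -1 by norm_num,
    Real.rpow_neg_one] at h
  rw [le_div_iff₀ hC]
  refine le_trans (le_of_eq ?_) h
  ring

theorem exp_level_zero_le {M U d : ℝ} (hM : 1 ≤ M) (hd : d ≤ M) (hU : 7056 * M ≤ U) :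
    Real.exp (M * 7 + d - 4 / 25 * U) ≤ Real.exp (-(U / 8)) * (1 / 2) ^ (0 + 1) := by
  have h2 : Real.exp (-1) ≤ 1 / 2 := by
    have := Real.exp_neg_one_lt_half
    linarith
  calc _ ≤ Real.exp (-(U / 8) + -1) := Real.exp_le_exp.2 (by linarith)
    _ ≤ _ := by rw [Real.exp_add, zero_add, pow_one]; gcongr

/-- Bernoulli gives `(9 / 4) ^ k ≥ 1 + k`, so the exponent dominates the linear entropy, `U / 8` and
the `k + 2` units that pay for the powers of `1 / 2`. -/
theorem exp_level_succ_le {M U d : ℝ} (hM : 1 ≤ M) (hd : d ≤ M) (hU : 7056 * M ≤ U) (k : ℕ) :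
    Real.exp (M * (7 + (k + 1 : ℕ)) + d - 18 / 25 * (9 / 4) ^ k * U)
      ≤ Real.exp (-(U / 8)) * (1 / 2) ^ (k + 1 + 1) := by
  have h2 : Real.exp (-1) ≤ 1 / 2 := by
    have := Real.exp_neg_one_lt_half
    linarith
  have hB : (1 : ℝ) + k ≤ (9 / 4) ^ k := by
    have := one_add_mul_le_pow (a := (5 / 4 : ℝ)) (by norm_num) k
    norm_num at this
    have hk : (0 : ℝ) ≤ k := Nat.cast_nonneg k
    linarith
  have hk : (0 : ℝ) ≤ k := Nat.cast_nonneg k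
  have hkM : (k : ℝ) ≤ k * M := le_mul_of_one_le_right hk hM
  have hkU : 7056 * (k * M) ≤ k * U := by nlinarith
  have hBU : (1 + k) * U ≤ (9 / 4) ^ k * U := by
    gcongr
    linarith
  calc _ ≤ Real.exp (-(U / 8) + ((k + 1 + 1 : ℕ) : ℝ) * -1) := by
        refine Real.exp_le_exp.2 ?_
        push_cast
        nlinarith
    _ ≤ _ := by rw [Real.exp_add, Real.exp_nat_mul]; gcongr

end GPTail

namespace GPTail

/-- Failure at every `k` lies in each single failure event, and their probabilities tend to 0. -/
theorem ae_exists_norm_vecField_sub_lt {T Ω : Type*} [NormedAddCommGroup T] [MeasurableSpace Ω]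
    {μ : Measure Ω} [IsProbabilityMeasure μ] {d : ℕ} {f : Fin d → T → Ω → ℝ} {c : T → T → ℝ}
    (hf : ∀ i, IsCenteredGP μ (f i) c) (hind : iIndepFun (fun i ω x => f i x ω) μ) {L α : ℝ}
    (hL : IsHolderKernel c L α) {x : T} {y : ℕ → T} {r : ℕ → ℝ} (hr : ∀ k, 0 < r k)
    (hxy : ∀ k, dist x (y k) ≤ r k) (hlim : Tendsto (fun k => L * r k ^ α) atTop (𝓝 0)) {ε : ℝ}
    (hε : 0 < ε) :
    ∀ᵐ ω ∂μ, ∃ k, ‖vecField f x ω - vecField f (y k) ω‖ < ε := by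
  have hpos : ∀ k, 0 < L * r k ^ α := fun k => mul_pos hL.const_pos (Real.rpow_pos_of_pos (hr k) _)
  have hlim' : Tendsto (fun k => ε ^ 2 / (8 * (L * r k ^ α))) atTop atTop := by
    have h0 : Tendsto (fun k => 8 * (L * r k ^ α)) atTop (𝓝[>] 0) :=
      tendsto_nhdsWithin_iff.2 ⟨by simpa using hlim.const_mul 8,
        Eventually.of_forall fun k => mul_pos (by norm_num) (hpos k)⟩
    simpa only [div_eq_mul_inv, Function.comp_def] using
      (tendsto_inv_nhdsGT_zero.comp h0).const_mul_atTop (by positivity : 0 < ε ^ 2)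
  have hbound : Tendsto (fun k => ENNReal.ofReal
      (2 ^ d * Real.exp (-(ε ^ 2 / (8 * (L * r k ^ α)))))) atTop (𝓝 0) := by
    have := (Real.tendsto_exp_neg_atTop_nhds_zero.comp hlim').const_mul ((2 : ℝ) ^ d)
    simpa using ENNReal.tendsto_ofReal this
  rw [ae_iff]
  refine le_antisymm (ge_of_tendsto' hbound fun k => ?_) zero_le
  refine (measure_mono fun ω hω => ?_).trans
    (measure_le_norm_vecField_sub_le hf hind hL (hr k) (hxy k) hε.le)
  exact not_lt.1 fun h => hω ⟨k, h⟩

theorem biSup_enorm_lt_of_separable {T F : Type*} [TopologicalSpace T] [NormedAddCommGroup F]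
    {X : T → F} {Z Z₀ : Set T} {b u : ℝ} (hbu : b < u) (hu : 0 < u)
    (hsep : ∀ x ∈ Z, ∃ z : ℕ → T, (∀ n, z n ∈ Z₀) ∧ Tendsto z atTop (𝓝 x) ∧
      Tendsto (fun n => X (z n)) atTop (𝓝 (X x)))
    (hb : ∀ z ∈ Z₀, ‖X z‖ ≤ b) :
    ⨆ x ∈ Z, ‖X x‖ₑ < ENNReal.ofReal u := by
  refine lt_of_le_of_lt (iSup₂_le fun x hx => ?_) ((ENNReal.ofReal_lt_ofReal_iff hu).2 hbu)
  obtain ⟨z, hz, -, hlim⟩ := hsep x hx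
  rw [← ofReal_norm]
  exact ENNReal.ofReal_le_ofReal (le_of_tendsto' hlim.norm fun n => hb _ (hz n))

end GPTail

theorem mainTheorem6 {Ω : Type*} [MeasurableSpace Ω] (μ : Measure Ω) [IsProbabilityMeasure μ]
    (ds da : ℕ)
    (c : EuclideanSpace ℝ (Fin (ds + da)) → EuclideanSpace ℝ (Fin (ds + da)) → ℝ)
    (C L α : ℝ) (hC : GPTail.IsBoundedKernel c C) (hL : GPTail.IsHolderKernel c L α)
    (f : Fin ds → EuclideanSpace ℝ (Fin (ds + da)) → Ω → ℝ)
    (hf : ∀ i, GPTail.IsCenteredGP μ (f i) c)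
    (hind : iIndepFun (fun i ω x => f i x ω) μ)
    (R : ℝ) (hR : 0 < R)
    (hsep : GPTail.IsSeparableOn μ (GPTail.vecField f) (Metric.closedBall 0 R))
    (u : ℝ)
    (hu : 84 * α ^ (-(1 / 2) : ℝ)
        * √(C * ((ds : ℝ) + (da : ℝ)) * Real.log (5 + 5 * R ^ α * L / C)) ≤ u) :
    μ {ω | ENNReal.ofReal u ≤
        ⨆ x ∈ Metric.closedBall (0 : EuclideanSpace ℝ (Fin (ds + da))) R,
          ‖GPTail.vecField f x ω‖ₑ}
      ≤ ENNReal.ofReal (Real.exp (-(u ^ 2 / (8 * C)))) := by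
  have hCpos := hC.const_pos
  have hLpos := hL.const_pos
  have hα := hL.exponent_pos
  have hα1 := hL.exponent_le_one
  have hu0 : 0 ≤ u := le_trans (by positivity) hu
  -- Degenerate cases: the bound is 1 if `u = 0`, and the field vanishes if `ds = 0`. Otherwise `M ≥
  -- 1`.
  rcases hu0.eq_or_lt with rfl | hupos
  · simp
  rcases Nat.eq_zero_or_pos ds with rfl | hds
  · have : {ω | ENNReal.ofReal u ≤
        ⨆ x ∈ Metric.closedBall (0 : EuclideanSpace ℝ (Fin (0 + da))) R,
          ‖GPTail.vecField f x ω‖ₑ} = ∅ := by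
      ext ω
      have h0 : ∀ x, GPTail.vecField f x ω = 0 := fun x => Subsingleton.elim _ _
      simp [h0, hupos]
    rw [this, measure_empty]
    exact zero_le
  set Λ := Real.log (5 + 5 * R ^ α * L / C) with hΛdef
  have hΛ : 1 ≤ Λ := by
    have : 0 ≤ 5 * R ^ α * L / C := by positivity
    rw [hΛdef, Real.le_log_iff_exp_le (by linarith)]
    linarith [Real.exp_one_lt_d9]
  set M := ((ds : ℝ) + da) * Λ / α with hM
  have hdsM : (ds : ℝ) ≤ M := by
    have h1 : (ds : ℝ) ≤ ds + da := by simp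
    rw [hM, le_div_iff₀ hα]
    have := mul_le_mul h1 (hα1.trans hΛ) hα.le (by positivity)
    linarith
  have hM1 : 1 ≤ M := le_trans (by exact_mod_cast hds) hdsM
  set U := u ^ 2 / C with hUdef
  have hU : 7056 * M ≤ U :=
    GPTail.entropy_le_sq (by positivity) hCpos hα (by linarith) hu
  -- With this offset the link exponent is `18 / 25 * (9 / 4) ^ k * U`.
  let a : ℕ → ℝ := fun k => (1 / 4) ^ (6 + k)
  have ha : ∀ k, 0 < a k := fun k => by positivity
  let r : ℕ → ℝ := fun k => (C * a k / L) ^ α⁻¹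
  have hr : ∀ k, 0 < r k := fun k => by
    have := ha k
    positivity
  have hra : ∀ k, L * r k ^ α = C * a k := fun k => by
    have := ha k
    simp only [r]
    rw [← Real.rpow_mul (by positivity), inv_mul_cancel₀ hα.ne', Real.rpow_one]
    field_simp
  choose S hSball hScov hScard using fun k =>
    Metric.exists_finset_net_closedBall (E := EuclideanSpace ℝ (Fin (ds + da))) hR.le (hr k)
  choose! near hnearS hnear using hScov
  have hcard : ∀ k, ((S k).card : ℝ) ≤ Real.exp (M * (7 + k)) := fun k => by
    refine (hScard k).trans ((pow_le_pow_left₀ (by have := hr k; positivity)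
      (GPTail.one_add_two_mul_div_le_exp hR hCpos hLpos hα hα1 (hr k) k rfl (hra k)) _).trans_eq ?_)
    rw [finrank_euclideanSpace_fin, ← Real.exp_nat_mul, hM]
    push_cast
    congr 1
    ring
  let V := GPTail.vecField f
  let B : ℕ → Set Ω
    | 0 => ⋃ t ∈ S 0, {ω | 4 / 5 * u ≤ ‖V t ω‖}
    | k + 1 => ⋃ t ∈ S (k + 1), {ω | (3 / 4) ^ (k + 1) / 20 * u ≤ ‖V t ω - V (near k t) ω‖}
  have hB : ∀ k, μ (B k) ≤ ENNReal.ofReal (Real.exp (-(U / 8)) * (1 / 2) ^ (k + 1))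
    | 0 => by
      refine (GPTail.measure_biUnion_finset_le_exp (hcard 0) fun t _ =>
        GPTail.measure_le_norm_vecField_le hf hind hC t (by positivity)).trans
        (ENNReal.ofReal_le_ofReal
          (le_of_eq_of_le ?_ (GPTail.exp_level_zero_le hM1 hdsM hU)))
      congr 1
      rw [hUdef]
      push_cast
      field_simp
      ring
    | k + 1 => by
      refine (GPTail.measure_biUnion_finset_le_exp (hcard (k + 1)) fun t ht =>
        GPTail.measure_le_norm_vecField_sub_le hf hind hL (hr k)
          (hnear k t (hSball _ ht)) (by positivity)).trans
        (ENNReal.ofReal_le_ofReal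
          (le_of_eq_of_le ?_ (GPTail.exp_level_succ_le hM1 hdsM hU k)))
      rw [hra]
      congr 2
      rw [hUdef]
      simp only [a]
      rw [show (9 / 4 : ℝ) ^ k = ((3 / 4) ^ k) ^ 2 * 4 ^ k by
        rw [← pow_mul, mul_comm k 2, pow_mul, ← mul_pow]; norm_num, pow_add (1 / 4 : ℝ),
        one_div_pow _ k, pow_succ]
      field_simp
      ring
  have hsum : μ (⋃ k, B k) ≤ ENNReal.ofReal (Real.exp (-(U / 8))) := by
    refine (measure_iUnion_le B).trans ((ENNReal.tsum_le_tsum hB).trans_eq ?_)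
    have hs : HasSum (fun k : ℕ => Real.exp (-(U / 8)) * (1 / 2 : ℝ) ^ (k + 1))
        (Real.exp (-(U / 8))) := by
      simpa [pow_succ', div_eq_mul_inv] using (hasSum_geometric_two' 1).mul_left (Real.exp (-(U / 8)))
    rw [← ENNReal.ofReal_tsum_of_nonneg (fun k => by positivity) hs.summable, hs.tsum_eq]
  have halim : Tendsto (fun k => L * r k ^ α) atTop (𝓝 0) := by
    simp only [hra, a, pow_add]
    simpa using ((tendsto_pow_atTop_nhds_zero_of_lt_one (r := (1 / 4 : ℝ)) (by norm_num)
      (by norm_num)).const_mul ((4 ^ 6)⁻¹)).const_mul C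
  obtain ⟨Z₀, hZ₀, hZ₀c, hsep⟩ := hsep
  -- `19 / 20 + 1 / 50 < 49 / 50`, so the supremum stays strictly below `u`.
  have hclose : ∀ᵐ ω ∂μ, ∀ z ∈ Z₀, ∃ k, ‖V z ω - V (near k z) ω‖ < u / 50 :=
    (ae_ball_iff hZ₀c).2 fun z hz => GPTail.ae_exists_norm_vecField_sub_lt hf hind hL hr
      (fun k => hnear k z (hZ₀ hz)) halim (by positivity)
  rw [show u ^ 2 / (8 * C) = U / 8 by rw [hUdef]; field_simp]
  refine (measure_mono_ae ?_).trans hsum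
  filter_upwards [hsep, hclose] with ω hω hcl hmem
  by_contra hnB
  have hgood : ∀ k, ω ∉ B k := fun k hk => hnB (Set.mem_iUnion.2 ⟨k, hk⟩)
  have hchain := GPTail.norm_le_of_chain (X := fun t => V t ω) (S := S) (near := near) (u := u)
    (fun t ht => by
      by_contra! h
      exact hgood 0 (Set.mem_iUnion₂.2 ⟨t, ht, h.le⟩))
    (fun k t ht => hnearS k t (hSball _ ht))
    (fun k t ht => by
      by_contra! h
      exact hgood (k + 1) (Set.mem_iUnion₂.2 ⟨t, ht, h.le⟩))
  refine absurd hmem (not_le.2 (GPTail.biSup_enorm_lt_of_separable (X := fun t => V t ω)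
    (b := 49 / 50 * u) (by linarith) hupos hω fun z hz => ?_))
  obtain ⟨k, hk⟩ := hcl z hz
  have h1 := hchain k _ (hnearS k z (hZ₀ hz))
  have h2 : 0 ≤ (3 / 4 : ℝ) ^ k * u := by positivity
  have h3 : ‖V z ω‖ ≤ ‖V (near k z) ω‖ + ‖V z ω - V (near k z) ω‖ := norm_le_insert' _ _
  change ‖V z ω‖ ≤ _
  linarith
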